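/- **Theorem.** Let $L\ge 1$, let $\mathcal X$ be a finite set of non-negative integers, and let $\mathcal D_1,\dots,\mathcal D_L$ be probability distributions (arms) on $\mathcal X$. Let $k\ge 1$. For a finite multiset $S$ of elements of $\mathcal X$ let $S_{(j)}$ be its $j$-th largest element, counted with multiplicity ($S_{(j)}=0$ if $|S|<j$), and let $\mathrm{STK}(S)=\sum_{j=1}^{k}S_{(j)}$ be the sum of its (up to) $k$ largest elements. Start with $S_0=\emptyset$. In iteration $t=1,2,\dots$ an adaptive algorithm chooses an arm $l_t\in\{1,\dots,L\}$, possibly at random, depending on the arms and scores of the previous iterations; then a fresh score $x_t\sim\mathcal D_{l_t}$ is drawn, independently of the past given $l_t$, and $S_t=S_{t-1}+\{x_t\}$. Let $\mathrm{OPT}=\mathrm{OPT}(T)$ be the largest value of $\mathbb E[\mathrm{STK}(S_T)]$ over all adaptive algorithms; these may depend on $\mathcal D_1,\dots,\mathcal D_L$, $k$ and $T$. The $\varepsilon$-greedy algorithm, which knows neither the distributions nor $T$, acts as follows in iteration $t$. With probability $\varepsilon_t=t^{-1/3}$ it chooses an arm uniformly at random. Otherwise it chooses an arm $l$ that maximizes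 the estimated expected marginal gain $$\sum_{x\in\mathcal X}\frac{N_{l,x}}{N_l}\,\max\bigl(x-(S_{t-1})_{(k)},\,0\bigr),$$ where $N_l$ is the number of earlier iterations in which arm $l$ was sampled and $N_{l,x}$ is the number of those that returned the score $x$; the estimate is $0$ if $N_l=0$, and ties are broken arbitrarily, possibly at random. Then for every $T\ge 1$ the $\varepsilon$-greedy algorithm satisfies $$\mathbb E[\mathrm{STK}(S_T)]\;\ge\;\Bigl(1-e^{-1-\frac1{2T}}\Bigr)\,\mathrm{OPT}\;-\;\tilde O\bigl(T^{2/3}\bigr).$$ Here $\tilde O(T^{2/3})$ stands for a quantity at most $C\,T^{2/3}(1+\log T)^p$, where $p$ is an absolute constant and $C$ depends only on $L$ and $\mathcal X$, not on the distributions, on $k$, on $T$ or on the tie-breaking. -/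

import Mathlib

open scoped NNReal ENNReal

noncomputable section

namespace TopKBandit

/-- The `k`-th largest element (`k ≥ 1`) of a multiset of scores, counted with multiplicity;
it is `0` when the multiset has fewer than `k` elements. -/
def kthLargest (k : ℕ) (S : Multiset ℕ) : ℕ :=
  (S.sort (· ≥ ·)).getD (k - 1) 0

/-- Sum of the (up to) `k` largest elements of a multiset of scores. -/
def stk (k : ℕ) (S : Multiset ℕ) : ℕ :=
  ((S.sort (· ≥ ·)).take k).sum

/-- What has been observed in the first `t` iterations with `L` arms and score domain `X`:
in each iteration, the arm that was sampled and the score that it returned. -/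
abbrev History (L : ℕ) (X : Finset ℕ) (t : ℕ) : Type :=
  Fin t → Fin L × X

/-- The multiset `S_t` of all scores sampled so far. -/
def scores {L : ℕ} {X : Finset ℕ} {t : ℕ} (h : History L X t) : Multiset ℕ :=
  (Finset.univ : Finset (Fin t)).val.map fun i => ((h i).2 : ℕ)

/-- An adaptive, possibly randomized, algorithm: the law of the next arm given the history. -/
abbrev Policy (L : ℕ) (X : Finset ℕ) : Type :=
  (t : ℕ) → History L X t → PMF (Fin L)

/-- The law of the history after `t` iterations of the algorithm `π`, when arm `l` returns
independent scores with distribution `D l`. -/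
def historyLaw {L : ℕ} {X : Finset ℕ} (D : Fin L → PMF X) (π : Policy L X) :
    (t : ℕ) → PMF (History L X t)
  | 0 => PMF.pure Fin.elim0
  | t + 1 =>
    (historyLaw D π t).bind fun h =>
      (π t h).bind fun l =>
        (D l).bind fun x =>
          PMF.pure (Fin.snoc (α := fun _ => Fin L × X) h (l, x))

/-- `𝔼[STK(S_T)]` for the algorithm `π` (a finite sum, as there are finitely many histories). -/
def expectedSTK {L : ℕ} {X : Finset ℕ} (D : Fin L → PMF X) (k : ℕ) (π : Policy L X)
    (T : ℕ) : ℝ :=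
  ∑ h : History L X T, (historyLaw D π T h).toReal * (stk k (scores h) : ℝ)

/-- `OPT`: the optimal value of `𝔼[STK(S_T)]` over all adaptive algorithms; these may depend on
the distributions `D`, on `k` and on `T`. -/
def OPT {L : ℕ} {X : Finset ℕ} (D : Fin L → PMF X) (k T : ℕ) : ℝ :=
  ⨆ π : Policy L X, expectedSTK D k π T

/-- The supremum that defines `OPT` is over a bounded family. -/
theorem bddAbove_expectedSTK {L : ℕ} {X : Finset ℕ} (D : Fin L → PMF X) (k T : ℕ) :
    BddAbove (Set.range fun π : Policy L X => expectedSTK D k π T) := by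
  refine ⟨∑ h : History L X T, (stk k (scores h) : ℝ), ?_⟩
  rintro _ ⟨π, rfl⟩
  refine Finset.sum_le_sum fun h _ => ?_
  refine mul_le_of_le_one_left (Nat.cast_nonneg _) ?_
  exact ENNReal.toReal_le_of_le_ofReal zero_le_one (by simpa using PMF.coe_le_one _ h)

/-- `N_l`: how often arm `l` has been sampled. -/
def visits {L : ℕ} {X : Finset ℕ} {t : ℕ} (h : History L X t) (l : Fin L) : ℕ :=
  (Finset.univ.filter fun i : Fin t => (h i).1 = l).card

/-- `N_{l,x}`: how often arm `l` has been sampled and has returned the score `x`. -/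
def visitsWith {L : ℕ} {X : Finset ℕ} {t : ℕ} (h : History L X t) (l : Fin L) (x : X) : ℕ :=
  (Finset.univ.filter fun i : Fin t => h i = (l, x)).card

/-- The estimated expected marginal gain in STK from sampling arm `l`,
`∑ x, N_{l,x} / N_l * max (x - S_(k)) 0`. The estimate of an arm that was never sampled
(whose histogram is empty) is `0`. -/
def estimatedGain {L : ℕ} {X : Finset ℕ} {t : ℕ} (k : ℕ) (h : History L X t) (l : Fin L) : ℝ :=
  ∑ x : X, (visitsWith h l x : ℝ) / (visits h l : ℝ) *
    max (((x : ℕ) : ℝ) - (kthLargest k (scores h) : ℝ)) 0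

/-- `g` is a greedy rule: it only chooses arms that maximize the estimated gain. Ties may be
broken in any way, also at random. -/
def IsGreedyRule {L : ℕ} {X : Finset ℕ} (k : ℕ) (g : Policy L X) : Prop :=
  ∀ (t : ℕ) (h : History L X t), ∀ l ∈ (g t h).support,
    ∀ l' : Fin L, estimatedGain k h l' ≤ estimatedGain k h l

/-- The exploration rate `ε_t = t ^ (-1/3)`; iterations are numbered from `1`. -/
def explorationRate (t : ℕ) : ℝ≥0 :=
  (t : ℝ≥0) ^ (-(1 / 3) : ℝ)

theorem explorationRate_le_one (t : ℕ) : explorationRate (t + 1) ≤ 1 :=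
  NNReal.rpow_le_one_of_one_le_of_nonpos (by simp) (by norm_num)

/-- A coin that shows `true` (explore) with probability `ε_{t+1}`. -/
def explorationCoin (t : ℕ) : PMF Bool :=
  PMF.ofFintype
    (fun b => cond b (explorationRate (t + 1) : ℝ≥0∞) (1 - (explorationRate (t + 1) : ℝ≥0∞)))
    (by simpa using add_tsub_cancel_of_le (ENNReal.coe_le_one_iff.2 (explorationRate_le_one t)))

/-- The `ε`-greedy algorithm with greedy rule `g`: after `t` iterations, iteration `t + 1`
explores a uniformly random arm with probability `ε_{t+1}`, and otherwise follows `g`. -/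
def epsGreedy {L : ℕ} [NeZero L] {X : Finset ℕ} (g : Policy L X) : Policy L X :=
  fun t h => (explorationCoin t).bind fun explore =>
    if explore then PMF.uniformOfFintype (Fin L) else g t h

end TopKBandit

end

/-! Fix a threshold `c`. Since `x ≤ c + (x - c)⁺`, any `T` scores satisfy `STK ≤ k c + ∑ (x - c)⁺`.
The right side is additive over iterations, so adaptivity cannot help: `OPT ≤ k c + T max_l gain c
l` (`OPT_le`). Taking for `c` the current `k`-th largest score of the `ε`-greedy run gives `k c ≤
STK(S_t)`, so the best arm gains at least `(OPT - STK(S_t)) / T`. Up to an error `δ_t`, one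
iteration therefore shrinks the expected gap to `OPT` by the factor `1 - 1/T`, and `(1 - 1/T)^T ≤
exp(-1 - 1/(2T))`.

The error `δ_t` comes from exploring (order `ε_t`) and from misjudged gains. The sample sizes `N_l`
are random and depend on the scores, so the estimates are controlled through two processes: `1/(N_l
+ 1)`, whose mean is `O(L ε_t²)` thanks to exploration, and `d²/(N_l + 1) - H_{N_l}`, a
supermartingale, where `d` is the centred count of a score and `H` the harmonic numbers. A weighted
AM-GM inequality combines them into an error of order `ε_t (1 + log T)`, and `∑ ε_t = O(T^{2/3})`.
-/

open scoped NNReal ENNReal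

noncomputable section

namespace TopKBandit

/-! ### Expectations over finite types -/

/-- The expectation of a real function under a probability mass function on a finite type. -/
def expect {α : Type*} [Fintype α] (p : PMF α) (f : α → ℝ) : ℝ :=
  ∑ a, (p a).toReal * f a

section Expect

variable {α β : Type*} [Fintype α] [Fintype β]

theorem sum_toReal_eq_one (p : PMF α) : ∑ a, (p a).toReal = 1 := by
  rw [← ENNReal.toReal_sum fun a _ => p.apply_ne_top a,
    ← tsum_fintype (L := .unconditional α) (fun a => p a),
    p.tsum_coe, ENNReal.toReal_one]

theorem expect_const (p : PMF α) (c : ℝ) : expect p (fun _ => c) = c := by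
  rw [expect, ← Finset.sum_mul, sum_toReal_eq_one, one_mul]

theorem expect_add (p : PMF α) (f g : α → ℝ) :
    expect p (fun a => f a + g a) = expect p f + expect p g := by
  simp only [expect, mul_add, Finset.sum_add_distrib]

theorem expect_sub (p : PMF α) (f g : α → ℝ) :
    expect p (fun a => f a - g a) = expect p f - expect p g := by
  simp only [expect, mul_sub, Finset.sum_sub_distrib]

theorem expect_const_mul (p : PMF α) (c : ℝ) (f : α → ℝ) :
    expect p (fun a => c * f a) = c * expect p f := by
  simp only [expect, Finset.mul_sum]
  exact Finset.sum_congr rfl fun a _ => by ring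

theorem expect_sum {ι : Type*} (s : Finset ι) (p : PMF α) (f : ι → α → ℝ) :
    expect p (fun a => ∑ i ∈ s, f i a) = ∑ i ∈ s, expect p (f i) := by
  simp only [expect, Finset.mul_sum]
  exact Finset.sum_comm

/-- The support matters because a greedy rule constrains only the arms that it may choose. -/
theorem expect_mono_support (p : PMF α) {f g : α → ℝ} (h : ∀ a ∈ p.support, f a ≤ g a) :
    expect p f ≤ expect p g := by
  refine Finset.sum_le_sum fun a _ => ?_
  by_cases ha : a ∈ p.support
  · exact mul_le_mul_of_nonneg_left (h a ha) ENNReal.toReal_nonneg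
  · simp [(p.apply_eq_zero_iff a).2 ha]

theorem expect_mono (p : PMF α) {f g : α → ℝ} (h : ∀ a, f a ≤ g a) : expect p f ≤ expect p g :=
  expect_mono_support p fun a _ => h a

theorem expect_nonneg (p : PMF α) {f : α → ℝ} (h : ∀ a, 0 ≤ f a) : 0 ≤ expect p f :=
  Finset.sum_nonneg fun a _ => mul_nonneg ENNReal.toReal_nonneg (h a)

theorem sq_expect_le (p : PMF α) (f : α → ℝ) : expect p f ^ 2 ≤ expect p (fun a => f a ^ 2) := by
  have h : 0 ≤ expect p (fun a => (f a ^ 2 - 2 * expect p f * f a) + expect p f ^ 2) :=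
    expect_nonneg p fun a => by nlinarith [sq_nonneg (f a - expect p f)]
  rw [expect_add, expect_sub, expect_const_mul, expect_const] at h
  linarith

theorem expect_pure (a : α) (f : α → ℝ) : expect (PMF.pure a) f = f a := by
  classical
  rw [expect, Finset.sum_eq_single a]
  · simp
  · intro b _ hb
    simp [PMF.pure_apply, hb]
  · simp

theorem expect_bind (p : PMF α) (q : α → PMF β) (f : β → ℝ) :
    expect (p.bind q) f = expect p fun a => expect (q a) f := by
  have h (b : β) : (p.bind q b).toReal = ∑ a, (p a).toReal * (q a b).toReal := by
    rw [PMF.bind_apply, tsum_fintype, ENNReal.toReal_sum]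
    · simp only [ENNReal.toReal_mul]
    · exact fun a _ => ENNReal.mul_ne_top (p.apply_ne_top a) ((q a).apply_ne_top b)
  simp only [expect, h, Finset.sum_mul, Finset.mul_sum]
  rw [Finset.sum_comm]
  exact Finset.sum_congr rfl fun a _ => Finset.sum_congr rfl fun b _ => by ring

theorem expect_ite_eq [DecidableEq α] (p : PMF α) (a : α) (c : ℝ) :
    expect p (fun b => if b = a then c else 0) = (p a).toReal * c := by
  simp [expect]

end Expect

/-! ### Top-`k` sums -/

/-- A new entry among the top `k + 1` pushes out the entry of index `k`; a smaller one changes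
nothing, which the truncated subtraction records. -/
theorem sum_take_orderedInsert (x : ℕ) (l : List ℕ) (hl : l.Pairwise (· ≥ ·)) (k : ℕ) :
    ((l.orderedInsert (· ≥ ·) x).take (k + 1)).sum
      = (l.take (k + 1)).sum + (x - l.getD k 0) := by
  induction l generalizing k with
  | nil => simp
  | cons b l ih =>
    have hb := List.pairwise_cons.1 hl
    by_cases hxb : x ≥ b
    · rw [List.orderedInsert_cons_of_le _ _ hxb, List.take_succ_cons, List.sum_cons]
      -- This makes the truncated subtraction exact.
      have hg : (b :: l).getD k 0 ≤ x := by
        cases k with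
        | zero => simpa using hxb
        | succ k =>
          rw [List.getD_cons_succ]
          by_cases hk : k < l.length
          · rw [List.getD_eq_getElem _ _ hk]
            exact (hb.1 _ (List.getElem_mem hk)).trans hxb
          · rw [List.getD_eq_default _ _ (not_lt.1 hk)]
            exact Nat.zero_le _
      have ht : ((b :: l).take (k + 1)).sum = ((b :: l).take k).sum + (b :: l).getD k 0 := by
        by_cases hk : k < (b :: l).length
        · rw [List.getD_eq_getElem _ _ hk, List.sum_take_succ _ _ hk]
        · rw [List.getD_eq_default _ _ (not_lt.1 hk), List.take_of_length_le (not_lt.1 hk),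
            List.take_of_length_le ((not_lt.1 hk).trans (Nat.le_succ k)), add_zero]
      omega
    · rw [List.orderedInsert_of_not_le _ _ hxb, List.take_succ_cons, List.take_succ_cons,
        List.sum_cons, List.sum_cons]
      cases k with
      | zero => simp; omega
      | succ k => rw [ih hb.2 k, List.getD_cons_succ, add_assoc]

theorem stk_cons {k : ℕ} (hk : 1 ≤ k) (x : ℕ) (S : Multiset ℕ) :
    stk k (x ::ₘ S) = stk k S + (x - kthLargest k S) := by
  obtain ⟨k, rfl⟩ := Nat.exists_eq_add_of_le' hk
  have hs : (x ::ₘ S).sort (· ≥ ·) = (S.sort (· ≥ ·)).orderedInsert (· ≥ ·) x := by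
    refine List.Perm.eq_of_pairwise' (Multiset.pairwise_sort _ _)
      ((Multiset.pairwise_sort S (· ≥ ·)).orderedInsert _ _) ?_
    rw [← Multiset.coe_eq_coe, Multiset.sort_eq,
      Multiset.coe_eq_coe.2 (List.perm_orderedInsert (· ≥ ·) x (S.sort (· ≥ ·))),
      ← Multiset.cons_coe, Multiset.sort_eq]
  rw [stk, hs, sum_take_orderedInsert x _ (Multiset.pairwise_sort S (· ≥ ·))]
  rfl

theorem mul_getD_le_sum_take (l : List ℕ) (hl : l.Pairwise (· ≥ ·)) (k : ℕ) :
    (k + 1) * l.getD k 0 ≤ (l.take (k + 1)).sum := by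
  by_cases hk : k < l.length
  · have h := List.card_nsmul_le_sum (l.take (k + 1)) (l.getD k 0) fun y hy => by
      obtain ⟨i, hi, rfl⟩ := List.mem_take_iff_getElem.1 hy
      rw [List.getD_eq_getElem _ _ hk]
      have hik : i ≤ k := by omega
      rcases hik.eq_or_lt with rfl | hik
      · exact le_rfl
      · exact List.pairwise_iff_getElem.1 hl i k (by omega) hk hik
    rwa [List.length_take, min_eq_left (by omega), smul_eq_mul] at h
  · rw [List.getD_eq_default _ _ (not_lt.1 hk), mul_zero]
    exact Nat.zero_le _

theorem mul_kthLargest_le_stk {k : ℕ} (hk : 1 ≤ k) (S : Multiset ℕ) :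
    k * kthLargest k S ≤ stk k S := by
  obtain ⟨k, rfl⟩ := Nat.exists_eq_add_of_le' hk
  exact mul_getD_le_sum_take _ (Multiset.pairwise_sort S (· ≥ ·)) k

/-- At most `k` elements pay `c` each, and counting the excess over `c` of all elements only adds.
The bound is additive in `S`, unlike `stk`. -/
theorem stk_le_mul_add_sum (k c : ℕ) (S : Multiset ℕ) :
    stk k S ≤ k * c + (S.map fun x => x - c).sum := by
  have h (l : List ℕ) (k : ℕ) : (l.take k).sum ≤ k * c + (l.map fun x => x - c).sum := by
    induction l generalizing k with
    | nil => simp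
    | cons b l ih =>
      cases k with
      | zero => simp
      | succ k =>
        have := ih k
        have hk : (k + 1) * c = k * c + c := by ring
        rw [List.take_succ_cons, List.sum_cons, List.map_cons, List.sum_cons]
        omega
  have h' := h (S.sort (· ≥ ·)) k
  rwa [← Multiset.sum_coe (List.map _ _), ← Multiset.map_coe, Multiset.sort_eq] at h'

/-! ### Extending a history by one iteration -/

section History

variable {L : ℕ} {X : Finset ℕ} {t : ℕ}

/-- The history `h` followed by one more iteration that sampled `a.1` and returned `a.2`. -/
abbrev extend (h : History L X t) (a : Fin L × X) : History L X (t + 1) :=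
  Fin.snoc (α := fun _ => Fin L × X) h a

theorem scores_extend (h : History L X t) (a : Fin L × X) :
    scores (extend h a) = (a.2 : ℕ) ::ₘ scores h := by
  rw [scores, Fin.univ_castSuccEmb, Finset.cons_val, Multiset.map_cons, Finset.map_val,
    Multiset.map_map]
  congr 1
  · simp [extend]
  · exact Multiset.map_congr rfl fun i _ => by simp [extend]

theorem visits_extend (h : History L X t) (a : Fin L × X) (l : Fin L) :
    visits (extend h a) l = visits h l + if a.1 = l then 1 else 0 := by
  rw [visits, visits, Finset.card_filter, Finset.card_filter, Fin.sum_univ_castSucc]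
  simp only [extend, Fin.snoc_castSucc, Fin.snoc_last]

theorem visitsWith_extend (h : History L X t) (a : Fin L × X) (l : Fin L) (x : X) :
    visitsWith (extend h a) l x = visitsWith h l x + if a = (l, x) then 1 else 0 := by
  rw [visitsWith, visitsWith, Finset.card_filter, Finset.card_filter, Fin.sum_univ_castSucc]
  simp only [extend, Fin.snoc_castSucc, Fin.snoc_last]

theorem visits_le (h : History L X t) (l : Fin L) : visits h l ≤ t := by
  simpa [visits] using Finset.card_filter_le (Finset.univ : Finset (Fin t)) fun i => (h i).1 = l

theorem visitsWith_le_visits (h : History L X t) (l : Fin L) (x : X) :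
    visitsWith h l x ≤ visits h l :=
  Finset.card_le_card fun i hi => by
    simp only [Finset.mem_filter, Finset.mem_univ, true_and] at hi ⊢
    rw [hi]

theorem expect_historyLaw_succ (D : Fin L → PMF X) (π : Policy L X) (t : ℕ)
    (f : History L X (t + 1) → ℝ) :
    expect (historyLaw D π (t + 1)) f = expect (historyLaw D π t) fun h =>
      expect (π t h) fun l => expect (D l) fun x => f (extend h (l, x)) := by
  simp only [historyLaw, expect_bind, expect_pure]

theorem expect_historyLaw_zero (D : Fin L → PMF X) (π : Policy L X) (f : History L X 0 → ℝ) :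
    expect (historyLaw D π 0) f = f Fin.elim0 := by
  simp only [historyLaw, expect_pure]

end History

/-! ### The expected marginal gain of an arm -/

section Gain

variable {L : ℕ} {X : Finset ℕ}

/-- The expected marginal gain of sampling an arm when the `k`-th largest score is `c`. -/
def gain (D : Fin L → PMF X) (c : ℕ) (l : Fin L) : ℝ :=
  expect (D l) fun x => (((x : ℕ) - c : ℕ) : ℝ)

theorem natCast_tsub_eq_max (a b : ℕ) : ((a - b : ℕ) : ℝ) = max ((a : ℝ) - b) 0 := by
  rcases le_total b a with h | h
  · rw [Nat.cast_sub h, max_eq_left (sub_nonneg.2 (Nat.cast_le.2 h))]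
  · rw [Nat.sub_eq_zero_of_le h, max_eq_right (sub_nonpos.2 (Nat.cast_le.2 h)), Nat.cast_zero]

theorem natCast_tsub_le_sup (x : X) (c : ℕ) : (((x : ℕ) - c : ℕ) : ℝ) ≤ (X.sup id : ℕ) :=
  Nat.cast_le.2 ((Nat.sub_le _ _).trans (Finset.le_sup (f := id) x.2))

theorem gain_nonneg (D : Fin L → PMF X) (c : ℕ) (l : Fin L) : 0 ≤ gain D c l :=
  expect_nonneg _ fun _ => Nat.cast_nonneg _

theorem gain_le_sup (D : Fin L → PMF X) (c : ℕ) (l : Fin L) : gain D c l ≤ (X.sup id : ℕ) :=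
  (expect_mono _ fun x => natCast_tsub_le_sup x c).trans_eq (expect_const _ _)

theorem expectedSTK_eq_expect (D : Fin L → PMF X) (k : ℕ) (π : Policy L X) (T : ℕ) :
    expectedSTK D k π T = expect (historyLaw D π T) fun h => (stk k (scores h) : ℝ) := rfl

theorem expectedSTK_zero (D : Fin L → PMF X) (k : ℕ) (π : Policy L X) :
    expectedSTK D k π 0 = 0 := by
  rw [expectedSTK_eq_expect, expect_historyLaw_zero]
  simp [scores, stk]

theorem expectedSTK_succ (D : Fin L → PMF X) {k : ℕ} (hk : 1 ≤ k) (π : Policy L X) (t : ℕ) :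
    expectedSTK D k π (t + 1) = expectedSTK D k π t
      + expect (historyLaw D π t) fun h =>
          expect (π t h) (gain D (kthLargest k (scores h))) := by
  simp only [expectedSTK_eq_expect, expect_historyLaw_succ, scores_extend, stk_cons hk,
    Nat.cast_add, expect_add, expect_const]
  rfl

/-- With `c` fixed in advance, each iteration adds at most `G` in expectation, whatever the history
and the arm. -/
theorem expect_sum_excess_le (D : Fin L → PMF X) (π : Policy L X) (c : ℕ) {G : ℝ}
    (hG : ∀ l, gain D c l ≤ G) (T : ℕ) :
    expect (historyLaw D π T) (fun h => ((((scores h).map fun x => x - c).sum : ℕ) : ℝ)) ≤ T * G := by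
  induction T with
  | zero =>
    rw [expect_historyLaw_zero]
    simp [scores]
  | succ t ih =>
    simp only [expect_historyLaw_succ, scores_extend, Multiset.map_cons, Multiset.sum_cons,
      Nat.cast_add, expect_add, expect_const]
    have h : expect (historyLaw D π t) (fun h => expect (π t h) fun l =>
        expect (D l) fun x => (((x : ℕ) - c : ℕ) : ℝ)) ≤ G :=
      (expect_mono _ fun h => (expect_mono _ hG).trans_eq (expect_const _ _)).trans_eq
        (expect_const _ _)
    push_cast at ih ⊢
    linarith

theorem OPT_le [NeZero L] (D : Fin L → PMF X) (k c : ℕ) {G : ℝ} (hG : ∀ l, gain D c l ≤ G)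
    (T : ℕ) : OPT D k T ≤ k * c + T * G := by
  have : Nonempty (Policy L X) := ⟨fun _ _ => PMF.pure 0⟩
  refine ciSup_le fun π => ?_
  have h : expectedSTK D k π T ≤ expect (historyLaw D π T)
      (fun h => (k * c : ℝ) + (((scores h).map fun x => x - c).sum : ℕ)) :=
    expect_mono _ fun h => by exact_mod_cast stk_le_mul_add_sum k c (scores h)
  rw [expect_add, expect_const] at h
  have := expect_sum_excess_le D π c hG T
  linarith

theorem OPT_nonneg (D : Fin L → PMF X) (k T : ℕ) : 0 ≤ OPT D k T :=
  Real.iSup_nonneg fun _ => expect_nonneg _ fun _ => Nat.cast_nonneg _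

end Gain

/-! ### Concentration of the empirical frequencies -/

section Concentration

variable {L : ℕ} {X : Finset ℕ}

theorem toReal_apply_le_one {α : Type*} (p : PMF α) (a : α) : (p a).toReal ≤ 1 :=
  ENNReal.toReal_le_of_le_ofReal zero_le_one (by simpa using PMF.coe_le_one p a)

/-- A visit lowers `1/(n+1)` by `1/((n+1)(n+2)) ≥ (n+1)⁻²/2` and has probability at least `q`;
Jensen's inequality then pulls the square out of the expectation. -/
theorem expect_inv_visits_succ_le (D : Fin L → PMF X) (π : Policy L X) (l : Fin L) (t : ℕ)
    {q : ℝ} (hq : 0 ≤ q) (hπ : ∀ h, q ≤ (π t h l).toReal) :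
    expect (historyLaw D π (t + 1)) (fun h => ((visits h l : ℝ) + 1)⁻¹)
      ≤ expect (historyLaw D π t) (fun h => ((visits h l : ℝ) + 1)⁻¹)
        - q / 2 * expect (historyLaw D π t) (fun h => ((visits h l : ℝ) + 1)⁻¹) ^ 2 := by
  have step (h : History L X t) :
      (expect (π t h) fun l' => expect (D l') fun x =>
          ((visits (extend h (l', x)) l : ℝ) + 1)⁻¹)
        ≤ ((visits h l : ℝ) + 1)⁻¹ - q / 2 * ((visits h l : ℝ) + 1)⁻¹ ^ 2 := by
    set n : ℝ := (visits h l : ℝ) with hn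
    have hn0 : 0 ≤ n := Nat.cast_nonneg _
    have heq (l' : Fin L) (x : X) : ((visits (extend h (l', x)) l : ℝ) + 1)⁻¹
        = (n + 1)⁻¹ - if l' = l then (n + 1)⁻¹ - (n + 1 + 1)⁻¹ else 0 := by
      rw [visits_extend]
      split_ifs <;> push_cast <;> simp [hn]
    simp only [heq, expect_const, expect_sub, expect_ite_eq]
    have h1 : (n + 1)⁻¹ ^ 2 / 2 ≤ (n + 1)⁻¹ - (n + 1 + 1)⁻¹ := by
      rw [inv_sub_inv (by positivity) (by positivity), inv_pow, ← one_div, div_div,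
        div_le_div_iff₀ (by positivity) (by positivity)]
      nlinarith
    have h2 : q * ((n + 1)⁻¹ ^ 2 / 2)
        ≤ (π t h l).toReal * ((n + 1)⁻¹ - (n + 1 + 1)⁻¹) :=
      mul_le_mul (hπ h) h1 (by positivity) ENNReal.toReal_nonneg
    linarith
  rw [expect_historyLaw_succ]
  refine (expect_mono _ step).trans ?_
  rw [expect_sub, expect_const_mul]
  have := sq_expect_le (historyLaw D π t) (fun h => ((visits h l : ℝ) + 1)⁻¹)
  gcongr

/-- Discrete form of: `u' ≤ -q u²/2` and `u(0) = 1` imply `1/u ≥ 1 + ∫ q/2`. -/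
theorem expect_inv_visits_mul_le_one (D : Fin L → PMF X) (π : Policy L X) (l : Fin L)
    (q : ℕ → ℝ) (hq : ∀ t, 0 ≤ q t) (hπ : ∀ t h, q t ≤ (π t h l).toReal) (t : ℕ) :
    expect (historyLaw D π t) (fun h => ((visits h l : ℝ) + 1)⁻¹)
      * (1 + (∑ i ∈ Finset.range t, q i) / 2) ≤ 1 := by
  induction t with
  | zero =>
    rw [expect_historyLaw_zero]
    simp [visits]
  | succ t ih =>
    have hstep := expect_inv_visits_succ_le D π l t (hq t) (hπ t)
    have hq1 : q t ≤ 1 := by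
      obtain ⟨h, _⟩ := (historyLaw D π t).support_nonempty
      exact (hπ t h).trans (toReal_apply_le_one _ _)
    have hu0 : 0 ≤ expect (historyLaw D π t) (fun h => ((visits h l : ℝ) + 1)⁻¹) :=
      expect_nonneg _ fun _ => by positivity
    rw [Finset.sum_range_succ]
    set u := expect (historyLaw D π t) (fun h => ((visits h l : ℝ) + 1)⁻¹)
    have hs0 : 0 ≤ ∑ i ∈ Finset.range t, q i := Finset.sum_nonneg fun i _ => hq i
    set s := ∑ i ∈ Finset.range t, q i
    have hu1 : u ≤ 1 := by nlinarith [mul_nonneg hu0 hs0]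
    have hqt := hq t
    have hqu : q t * u ≤ 1 := mul_le_one₀ hq1 hu0 hu1
    -- With `z = q t * u / 2`, the product is at most `(1 + z)(1 - z) ≤ 1`; `hqu` keeps `1 - z`
    -- nonnegative.
    calc _ ≤ (u - q t / 2 * u ^ 2) * (1 + (s + q t) / 2) := by gcongr
      _ = (u * (1 + s / 2) + q t * u / 2) * (1 - q t * u / 2) := by ring
      _ ≤ (1 + q t * u / 2) * (1 - q t * u / 2) := by
        gcongr
        linarith
      _ ≤ 1 := by nlinarith [sq_nonneg (q t * u / 2)]

/-- How far the number of times that arm `l` returned `x` is from its compensator. -/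
def deviation (D : Fin L → PMF X) {t : ℕ} (h : History L X t) (l : Fin L) (x : X) : ℝ :=
  visitsWith h l x - (D l x).toReal * visits h l

/-- A visit changes `d` by a centred amount of variance `p(1 - p) ≤ 1`, so `d²/(n+1)` grows in mean
by at most `1/(n+1)`, the increment of the harmonic number. Other arms change nothing. -/
theorem expect_sq_deviation_sub_harmonic_nonpos (D : Fin L → PMF X) (π : Policy L X) (l : Fin L)
    (x : X) (t : ℕ) :
    expect (historyLaw D π t) (fun h => deviation D h l x ^ 2 * ((visits h l : ℝ) + 1)⁻¹
      - (harmonic (visits h l) : ℝ)) ≤ 0 := by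
  induction t with
  | zero =>
    rw [expect_historyLaw_zero]
    simp [visits, visitsWith, deviation]
  | succ t ih =>
    rw [expect_historyLaw_succ]
    refine (expect_mono _ fun h => ?_).trans ih
    refine (expect_mono _ fun l' => ?_).trans_eq (expect_const _ _)
    rcases eq_or_ne l' l with rfl | hl
    · set p : ℝ := (D l' x).toReal with hp
      set d : ℝ := deviation D h l' x with hd
      -- The new deviation is `d - p`, plus `1` when `y = x`; the square is expanded along this
      -- indicator.
      have heq (y : X) : deviation D (extend h (l', y)) l' x ^ 2
            * ((visits (extend h (l', y)) l' : ℝ) + 1)⁻¹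
            - (harmonic (visits (extend h (l', y)) l') : ℝ)
          = ((visits h l' : ℝ) + 1 + 1)⁻¹
              * ((d - p) ^ 2 + if y = x then 2 * (d - p) + 1 else 0)
            - (harmonic (visits h l' + 1) : ℝ) := by
        rw [visits_extend, deviation, visits_extend, visitsWith_extend, hd, deviation, ← hp]
        by_cases hy : y = x
        · simp only [hy, if_true]
          push_cast
          ring
        · simp only [hy, if_true, if_false, Prod.mk.injEq, and_false]
          push_cast
          ring
      simp only [heq, expect_sub, expect_const_mul, expect_add, expect_const, expect_ite_eq,
        ← hp]
      rw [harmonic_succ]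
      push_cast
      have hn0 : (0 : ℝ) ≤ visits h l' := Nat.cast_nonneg _
      have hinv : ((visits h l' : ℝ) + 1 + 1)⁻¹ ≤ ((visits h l' : ℝ) + 1)⁻¹ := by
        gcongr
        linarith
      have hp0 : 0 ≤ p := ENNReal.toReal_nonneg
      have hp1 : p ≤ 1 := toReal_apply_le_one _ _
      have hsq : (d - p) ^ 2 + p * (2 * (d - p) + 1) ≤ d ^ 2 + 1 := by nlinarith
      have : ((visits h l' : ℝ) + 1 + 1)⁻¹ * ((d - p) ^ 2 + p * (2 * (d - p) + 1))
          ≤ ((visits h l' : ℝ) + 1)⁻¹ * (d ^ 2 + 1) :=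
        mul_le_mul hinv hsq (by nlinarith [sq_nonneg d]) (by positivity)
      linarith
    · refine (expect_mono _ fun y => le_of_eq ?_).trans_eq (expect_const _ _)
      rw [visits_extend, deviation, visits_extend, visitsWith_extend, deviation]
      simp [hl]

theorem expect_sq_deviation_le (D : Fin L → PMF X) (π : Policy L X) (l : Fin L) (x : X) (t : ℕ) :
    expect (historyLaw D π t) (fun h => deviation D h l x ^ 2 * ((visits h l : ℝ) + 1)⁻¹)
      ≤ 1 + Real.log t := by
  have h1 := expect_sq_deviation_sub_harmonic_nonpos D π l x t
  rw [expect_sub] at h1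
  have h2 : expect (historyLaw D π t) (fun h => (harmonic (visits h l) : ℝ))
      ≤ 1 + Real.log t := by
    refine (expect_mono _ fun h => ?_).trans_eq (expect_const _ _)
    rcases Nat.eq_zero_or_pos (visits h l) with h0 | h0
    · rw [h0, harmonic_zero, Rat.cast_zero]
      have := Real.log_natCast_nonneg t
      linarith
    · refine (harmonic_le_one_add_log _).trans ?_
      have := visits_le h l
      gcongr
  linarith

/-- The error of the empirical frequencies, in a form that also covers arms never sampled. -/
theorem abs_estimatedGain_sub_gain_le (D : Fin L → PMF X) (k : ℕ) {t : ℕ} (h : History L X t)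
    (l : Fin L) :
    |estimatedGain k h l - gain D (kthLargest k (scores h)) l|
      ≤ (X.sup id : ℕ) *
        ∑ x : X, (2 * |deviation D h l x| + 1) * ((visits h l : ℝ) + 1)⁻¹ := by
  simp only [estimatedGain, gain, expect, ← natCast_tsub_eq_max]
  rw [← Finset.sum_sub_distrib, Finset.mul_sum]
  refine (Finset.abs_sum_le_sum_abs _ _).trans (Finset.sum_le_sum fun x _ => ?_)
  rw [← sub_mul, abs_mul, mul_comm, abs_of_nonneg (Nat.cast_nonneg (α := ℝ) _)]
  refine mul_le_mul (natCast_tsub_le_sup x _) ?_ (abs_nonneg _) (Nat.cast_nonneg _)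
  -- An unvisited arm has frequency estimate `0` and error at most `1`, covered by the `+ 1`.
  -- Otherwise `1/n ≤ 2/(n+1)`.
  rcases Nat.eq_zero_or_pos (visits h l) with h0 | h0
  · have h1 : visitsWith h l x = 0 := Nat.le_zero.1 (h0 ▸ visitsWith_le_visits h l x)
    simpa [deviation, h0, h1] using toReal_apply_le_one (D l) x
  · have hn : (1 : ℝ) ≤ visits h l := by exact_mod_cast h0
    have heq : (visitsWith h l x : ℝ) / visits h l - (D l x).toReal
        = deviation D h l x / visits h l := by
      rw [deviation]
      field_simp
    rw [heq, abs_div, abs_of_nonneg (Nat.cast_nonneg (α := ℝ) _), ← div_eq_mul_inv,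
      div_le_div_iff₀ (by linarith) (by linarith)]
    nlinarith [abs_nonneg (deviation D h l x)]

end Concentration

/-! ### The exploration rate -/

theorem coe_explorationRate (t : ℕ) :
    (explorationRate t : ℝ) = (t : ℝ) ^ (-(1 / 3) : ℝ) := by
  simp [explorationRate]

theorem explorationRate_succ_pos (t : ℕ) : (0 : ℝ) < explorationRate (t + 1) := by
  rw [coe_explorationRate]
  positivity

theorem explorationRate_succ_le_one (t : ℕ) : (explorationRate (t + 1) : ℝ) ≤ 1 := by
  exact_mod_cast explorationRate_le_one t

theorem explorationRate_succ_antitone {s t : ℕ} (h : s ≤ t) :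
    (explorationRate (t + 1) : ℝ) ≤ explorationRate (s + 1) := by
  rw [coe_explorationRate, coe_explorationRate]
  exact Real.rpow_le_rpow_of_nonpos (by positivity) (by exact_mod_cast Nat.succ_le_succ h)
    (by norm_num)

theorem mul_explorationRate_pow_three (t : ℕ) :
    ((t : ℝ) + 1) * (explorationRate (t + 1) : ℝ) ^ 3 = 1 := by
  have h : (0 : ℝ) < (t : ℝ) + 1 := by positivity
  rw [coe_explorationRate, ← Real.rpow_natCast, ← Real.rpow_mul (by positivity)]
  push_cast
  rw [show (-(1 / 3) * 3 : ℝ) = -1 by norm_num, Real.rpow_neg_one, mul_inv_cancel₀ h.ne']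

theorem sum_explorationRate_le (T : ℕ) :
    ∑ t ∈ Finset.range T, (explorationRate (t + 1) : ℝ) ≤ 3 / 2 * (T : ℝ) ^ (2 / 3 : ℝ) := by
  induction T with
  | zero => simp
  | succ t ih =>
    rw [Finset.sum_range_succ, coe_explorationRate]
    push_cast
    have ht0 : (0 : ℝ) ≤ t := Nat.cast_nonneg t
    have ht : (0 : ℝ) < (t : ℝ) + 1 := by positivity
    -- Bernoulli's inequality for an exponent below `1`: raising `t` to `t + 1` increases `t^(2/3)`
    -- by at least `(2/3) (t+1)^(-1/3)`.
    have hb := rpow_one_add_le_one_add_mul_self (s := -(1 / ((t : ℝ) + 1))) (p := 2 / 3)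
      (by rw [neg_le_neg_iff, div_le_one ht]; linarith) (by norm_num) (by norm_num)
    have h1 : 1 + -(1 / ((t : ℝ) + 1)) = t / (t + 1) := by field_simp; ring
    rw [h1, Real.div_rpow ht0 ht.le, div_le_iff₀ (by positivity)] at hb
    have h2 : 1 / ((t : ℝ) + 1) * ((t : ℝ) + 1) ^ (2 / 3 : ℝ)
        = ((t : ℝ) + 1) ^ (-(1 / 3) : ℝ) := by
      rw [one_div, ← Real.rpow_neg_one, ← Real.rpow_add ht]
      norm_num
    nlinarith

/-! ### One iteration of the `ε`-greedy algorithm -/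

section Greedy

variable {L : ℕ} [NeZero L] {X : Finset ℕ}

theorem expect_epsGreedy (g : Policy L X) (t : ℕ) (h : History L X t) (f : Fin L → ℝ) :
    expect (epsGreedy g t h) f
      = explorationRate (t + 1) * expect (PMF.uniformOfFintype (Fin L)) f
        + (1 - explorationRate (t + 1)) * expect (g t h) f := by
  rw [epsGreedy, expect_bind]
  have h1 : ((1 : ℝ≥0∞) - (explorationRate (t + 1) : ℝ≥0∞)).toReal
      = 1 - (explorationRate (t + 1) : ℝ) := by
    rw [ENNReal.toReal_sub_of_le (ENNReal.coe_le_one_iff.2 (explorationRate_le_one t))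
      ENNReal.one_ne_top]
    simp
  simp [expect, explorationCoin, h1]

theorem explorationRate_div_le_epsGreedy (g : Policy L X) (t : ℕ) (h : History L X t)
    (l : Fin L) : (explorationRate (t + 1) : ℝ) / L ≤ (epsGreedy g t h l).toReal := by
  have h1 := expect_epsGreedy g t h fun l' => if l' = l then 1 else 0
  simp only [expect_ite_eq, mul_one, PMF.uniformOfFintype_apply, Fintype.card_fin,
    ENNReal.toReal_inv, ENNReal.toReal_natCast] at h1
  rw [h1, div_eq_mul_inv, le_add_iff_nonneg_right]
  exact mul_nonneg (sub_nonneg.2 (explorationRate_succ_le_one t)) ENNReal.toReal_nonneg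

/-- Exploration alone yields about `t ε_t / L` expected visits, as the rates decrease; and `1/((t+1)
ε) = ε²` for `ε = (t+1)^(-1/3)`. -/
theorem expect_inv_visits_epsGreedy_le (D : Fin L → PMF X) (g : Policy L X) (l : Fin L) (t : ℕ) :
    expect (historyLaw D (epsGreedy g) t) (fun h => ((visits h l : ℝ) + 1)⁻¹)
      ≤ 2 * L * (explorationRate (t + 1) : ℝ) ^ 2 := by
  have hL : (1 : ℝ) ≤ L := by exact_mod_cast NeZero.one_le
  have hu := expect_inv_visits_mul_le_one D (epsGreedy g) l
    (fun i => (explorationRate (i + 1) : ℝ) / L)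
    (fun i => div_nonneg (explorationRate_succ_pos i).le (by linarith))
    (fun i h => explorationRate_div_le_epsGreedy g i h l) t
  have hu0 : 0 ≤ expect (historyLaw D (epsGreedy g) t) (fun h => ((visits h l : ℝ) + 1)⁻¹) :=
    expect_nonneg _ fun _ => by positivity
  set u := expect (historyLaw D (epsGreedy g) t) (fun h => ((visits h l : ℝ) + 1)⁻¹)
  have hsum : t * (explorationRate (t + 1) : ℝ)
      ≤ ∑ i ∈ Finset.range t, (explorationRate (i + 1) : ℝ) := by
    simpa using Finset.card_nsmul_le_sum (Finset.range t) _ _ fun i hi =>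
      explorationRate_succ_antitone (Finset.mem_range.1 hi).le
  have he0 := explorationRate_succ_pos t
  have he1 := explorationRate_succ_le_one t
  have he3 := mul_explorationRate_pow_three t
  rw [← Finset.sum_div] at hu
  set e : ℝ := (explorationRate (t + 1) : ℝ)
  set s := ∑ i ∈ Finset.range t, (explorationRate (i + 1) : ℝ)
  have h1 : ((t : ℝ) + 1) * e ≤ 2 * L * (1 + s / L / 2) := by
    have : 2 * L * (1 + s / L / 2) = 2 * L + s := by field_simp
    linarith
  calc u = u * (((t : ℝ) + 1) * e ^ 3) := by rw [he3, mul_one]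
    _ = u * (((t : ℝ) + 1) * e) * e ^ 2 := by ring
    _ ≤ u * (2 * L * (1 + s / L / 2)) * e ^ 2 := by gcongr
    _ = (u * (1 + s / L / 2)) * (2 * L * e ^ 2) := by ring
    _ ≤ 1 * (2 * L * e ^ 2) := by gcongr
    _ = 2 * L * e ^ 2 := one_mul _

/-- By AM-GM, `2|d| ≤ e d² + e⁻¹`. The weight `e` balances the two expectations: `d²/(N+1)` is
logarithmic and `1/(N+1)` is `O(e²)`, so both terms are of order `e` up to the logarithm. -/
theorem expect_abs_deviation_le (D : Fin L → PMF X) (g : Policy L X) (l : Fin L) (x : X)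
    {t T : ℕ} (ht : t ≤ T) :
    expect (historyLaw D (epsGreedy g) t)
        (fun h => (2 * |deviation D h l x| + 1) * ((visits h l : ℝ) + 1)⁻¹)
      ≤ (4 * L + 1) * explorationRate (t + 1) * (1 + Real.log T) := by
  have hu := expect_inv_visits_epsGreedy_le D g l t
  have hv := expect_sq_deviation_le D (epsGreedy g) l x t
  have he0 := explorationRate_succ_pos t
  have he1 := explorationRate_succ_le_one t
  have hlog : Real.log t ≤ Real.log T := by
    rcases Nat.eq_zero_or_pos t with rfl | h0
    · simpa using Real.log_natCast_nonneg T
    · gcongr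
  have hlog0 := Real.log_natCast_nonneg T
  set e : ℝ := (explorationRate (t + 1) : ℝ)
  have hmono : expect (historyLaw D (epsGreedy g) t)
        (fun h => (2 * |deviation D h l x| + 1) * ((visits h l : ℝ) + 1)⁻¹)
      ≤ expect (historyLaw D (epsGreedy g) t)
        (fun h => e * (deviation D h l x ^ 2 * ((visits h l : ℝ) + 1)⁻¹)
          + (e⁻¹ + 1) * ((visits h l : ℝ) + 1)⁻¹) := by
    refine expect_mono _ fun h => ?_
    rw [← mul_assoc, ← add_mul]
    refine mul_le_mul_of_nonneg_right ?_ (by positivity)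
    have h1 : e * e⁻¹ = 1 := mul_inv_cancel₀ he0.ne'
    have h2 : e * deviation D h l x ^ 2 + e⁻¹ - 2 * |deviation D h l x|
        = e * (|deviation D h l x| - e⁻¹) ^ 2 := by
      rw [← sq_abs (deviation D h l x)]
      linear_combination (2 * |deviation D h l x| - e⁻¹) * h1
    have h3 : 0 ≤ e * (|deviation D h l x| - e⁻¹) ^ 2 := by positivity
    linarith
  rw [expect_add, expect_const_mul, expect_const_mul] at hmono
  have h1 : (e⁻¹ + 1) * (2 * L * e ^ 2) ≤ 4 * L * e := by
    have : (e⁻¹ + 1) * (2 * L * e ^ 2) = 2 * L * e + 2 * L * e * e := by field_simp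
    have : 2 * L * e * e ≤ 2 * L * e * 1 := by gcongr
    linarith
  have h2 : 4 * L * e ≤ 4 * L * e * (1 + Real.log T) :=
    le_mul_of_one_le_right (by positivity) (by linarith)
  calc _ ≤ _ := hmono
    _ ≤ e * (1 + Real.log T) + (e⁻¹ + 1) * (2 * L * e ^ 2) := by
      gcongr
      linarith
    _ ≤ (4 * L + 1) * e * (1 + Real.log T) := by linarith

theorem expect_abs_estimatedGain_sub_gain_le (D : Fin L → PMF X) (g : Policy L X) (k : ℕ)
    {t T : ℕ} (ht : t ≤ T) :
    expect (historyLaw D (epsGreedy g) t) (fun h => ∑ l : Fin L,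
        |estimatedGain k h l - gain D (kthLargest k (scores h)) l|)
      ≤ L * ((X.sup id : ℕ) *
        (X.card * ((4 * L + 1) * explorationRate (t + 1) * (1 + Real.log T)))) := by
  rw [expect_sum]
  refine (Finset.sum_le_card_nsmul _ _ _ fun l _ => ?_).trans_eq
    (by rw [nsmul_eq_mul, Finset.card_univ, Fintype.card_fin])
  refine (expect_mono _ fun h => abs_estimatedGain_sub_gain_le D k h l).trans ?_
  rw [expect_const_mul, expect_sum]
  refine mul_le_mul_of_nonneg_left ?_ (Nat.cast_nonneg _)
  refine (Finset.sum_le_card_nsmul _ _ _ fun x _ =>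
    expect_abs_deviation_le D g l x ht).trans_eq ?_
  rw [nsmul_eq_mul, Finset.card_univ, Fintype.card_coe]

/-- `OPT_le` is applied with the threshold `c` read off from the history `h`, which is legitimate
because it holds for every `c`. -/
theorem OPT_sub_stk_le (D : Fin L → PMF X) {k : ℕ} (hk : 1 ≤ k) {g : Policy L X}
    (hg : IsGreedyRule k g) (T : ℕ) {t : ℕ} (h : History L X t) :
    OPT D k T - stk k (scores h)
      ≤ T * (expect (epsGreedy g t h) (gain D (kthLargest k (scores h)))
        + (X.sup id : ℕ) * explorationRate (t + 1)
        + 2 * ∑ l : Fin L, |estimatedGain k h l - gain D (kthLargest k (scores h)) l|) := by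
  set c := kthLargest k (scores h) with hc
  obtain ⟨b, hb⟩ := Finite.exists_max (gain D c)
  have hopt := OPT_le D k c hb T
  have hstk : (k * c : ℝ) ≤ stk k (scores h) := by
    exact_mod_cast mul_kthLargest_le_stk hk (scores h)
  set err := ∑ l : Fin L, |estimatedGain k h l - gain D c l| with herr
  have herr0 : 0 ≤ err := Finset.sum_nonneg fun _ _ => abs_nonneg _
  have hle (l : Fin L) : |estimatedGain k h l - gain D c l| ≤ err :=
    Finset.single_le_sum (f := fun l => |estimatedGain k h l - gain D c l|)
      (fun _ _ => abs_nonneg _) (Finset.mem_univ l)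
  -- The chosen arm beats the best arm `b` in estimate, and each of the two estimates is off by at
  -- most `err`.
  have hgreedy : gain D c b - 2 * err ≤ expect (g t h) (gain D c) := by
    rw [← expect_const (g t h) (gain D c b - 2 * err)]
    refine expect_mono_support _ fun l hl => ?_
    have h1 := hg t h l hl b
    have h2 := (abs_le.1 (hle l)).2
    have h3 := (abs_le.1 (hle b)).1
    linarith
  have he0 := explorationRate_succ_pos t
  have he1 := explorationRate_succ_le_one t
  have hmax := gain_le_sup D c b
  have hstep : gain D c b ≤ expect (epsGreedy g t h) (gain D c)
      + (X.sup id : ℕ) * explorationRate (t + 1) + 2 * err := by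
    -- The gain while exploring is bounded below by `0`, which costs at most `e` times the maximal
    -- score.
    rw [expect_epsGreedy]
    set e : ℝ := (explorationRate (t + 1) : ℝ)
    have h1 : 0 ≤ e * expect (PMF.uniformOfFintype (Fin L)) (gain D c) :=
      mul_nonneg he0.le (expect_nonneg _ (gain_nonneg D c))
    have h2 := mul_le_mul_of_nonneg_left hgreedy (sub_nonneg.2 he1)
    have h3 := mul_le_mul_of_nonneg_right hmax he0.le
    have h4 := mul_nonneg he0.le herr0
    linarith
  have := mul_le_mul_of_nonneg_left hstep (Nat.cast_nonneg (α := ℝ) T)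
  linarith

theorem OPT_sub_expectedSTK_succ_le (D : Fin L → PMF X) {k : ℕ} (hk : 1 ≤ k) {g : Policy L X}
    (hg : IsGreedyRule k g) {T t : ℕ} (ht : t < T) :
    OPT D k T - expectedSTK D k (epsGreedy g) (t + 1)
      ≤ (1 - 1 / T) * (OPT D k T - expectedSTK D k (epsGreedy g) t)
        + (X.sup id : ℕ) * (1 + 2 * L * X.card * (4 * L + 1)) * (1 + Real.log T)
          * explorationRate (t + 1) := by
  have hT : (0 : ℝ) < T := by exact_mod_cast (Nat.zero_le t).trans_lt ht
  have h1 := expect_mono (historyLaw D (epsGreedy g) t) fun h => OPT_sub_stk_le D hk hg T h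
  rw [expect_sub, expect_const, expect_const_mul, expect_add, expect_add, expect_const,
    expect_const_mul, ← expectedSTK_eq_expect] at h1
  have h2 := expect_abs_estimatedGain_sub_gain_le D g k ht.le
  rw [expectedSTK_succ D hk]
  set a := OPT D k T - expectedSTK D k (epsGreedy g) t
  set G := expect (historyLaw D (epsGreedy g) t) fun h =>
    expect (epsGreedy g t h) (gain D (kthLargest k (scores h)))
  have h3 := (div_le_iff₀' hT).2 h1
  have h4 : (X.sup id : ℕ) * (explorationRate (t + 1) : ℝ)
      ≤ (X.sup id : ℕ) * explorationRate (t + 1) * (1 + Real.log T) :=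
    le_mul_of_one_le_right (by positivity) (by linarith [Real.log_natCast_nonneg T])
  have h5 : (1 - 1 / T) * a = a - a / T := by ring
  rw [h5]
  linarith

end Greedy

/-! ### Solving the recursion -/

theorem le_pow_mul_add_sum {a δ : ℕ → ℝ} {r : ℝ} (hr0 : 0 ≤ r) (hr1 : r ≤ 1)
    (hδ : ∀ t, 0 ≤ δ t) {T : ℕ} (h : ∀ t < T, a (t + 1) ≤ r * a t + δ t) :
    a T ≤ r ^ T * a 0 + ∑ t ∈ Finset.range T, δ t := by
  induction T with
  | zero => simp
  | succ t ih =>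
    have h1 := h t (Nat.lt_succ_self t)
    have h2 := ih fun s hs => h s (hs.trans (Nat.lt_succ_self t))
    have h3 : 0 ≤ ∑ s ∈ Finset.range t, δ s := Finset.sum_nonneg fun s _ => hδ s
    have h4 := mul_le_mul_of_nonneg_left h2 hr0
    have h5 := mul_le_of_le_one_left h3 hr1
    rw [Finset.sum_range_succ, pow_succ']
    linarith

/-- The first two terms of the logarithm series give `log(1 - y) ≤ -y - y²/2` at `y = 1/T`. For `T =
1` the left side is `0`. -/
theorem one_sub_inv_pow_le {T : ℕ} (hT : 1 ≤ T) :
    (1 - 1 / (T : ℝ)) ^ T ≤ Real.exp (-1 - 1 / (2 * (T : ℝ))) := by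
  rcases hT.eq_or_lt with rfl | hT
  · simpa using (Real.exp_pos _).le
  have hT' : (1 : ℝ) < T := by exact_mod_cast hT
  have hy0 : 0 < 1 / (T : ℝ) := by positivity
  have hy1 : 1 / (T : ℝ) < 1 := by rw [div_lt_one] <;> linarith
  have hs := sum_le_hasSum (Finset.range 2) (fun i _ => by positivity)
    (Real.hasSum_pow_div_log_of_abs_lt_one (x := 1 / (T : ℝ)) (by rwa [abs_of_pos hy0]))
  simp only [Finset.sum_range_succ, Finset.range_zero, Finset.sum_empty] at hs
  norm_num at hs
  have hpos : 0 < 1 - 1 / (T : ℝ) := by linarith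
  rw [← Real.log_le_iff_le_exp (by positivity), Real.log_pow]
  have h1 : Real.log (1 - 1 / (T : ℝ)) ≤ -(1 / T) - (1 / T) ^ 2 / 2 := by
    norm_num
    linarith
  calc _ ≤ (T : ℝ) * (-(1 / T) - (1 / T) ^ 2 / 2) := by gcongr
    _ = _ := by field_simp

end TopKBandit

end

/-- The constants do not depend on the distributions, on `k`, on `T` or on the tie-breaking. -/
theorem mainTheorem1 :
    ∃ p : ℕ, ∀ (L : ℕ) [NeZero L] (X : Finset ℕ), ∃ C : ℝ,
      ∀ (D : Fin L → PMF X) (k : ℕ), 1 ≤ k →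
        ∀ g : TopKBandit.Policy L X, TopKBandit.IsGreedyRule k g →
          ∀ T : ℕ, 1 ≤ T →
            (1 - Real.exp (-1 - 1 / (2 * (T : ℝ)))) * TopKBandit.OPT D k T
                - C * (T : ℝ) ^ (2 / 3 : ℝ) * (1 + Real.log (T : ℝ)) ^ p
              ≤ TopKBandit.expectedSTK D k (TopKBandit.epsGreedy g) T := by
  -- The single logarithm stems from the harmonic numbers, and `3 / 2` from the sum of the
  -- exploration rates.
  refine ⟨1, fun L _ X =>
    ⟨(X.sup id : ℕ) * (1 + 2 * L * X.card * (4 * L + 1)) * (3 / 2), fun D k hk g hg T hT => ?_⟩⟩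
  have hT' : (1 : ℝ) ≤ T := by exact_mod_cast hT
  have hlog := Real.log_natCast_nonneg T
  set K : ℝ := (X.sup id : ℕ) * (1 + 2 * L * X.card * (4 * L + 1)) with hK
  have hK0 : 0 ≤ K * (1 + Real.log T) := by positivity
  have hrec := TopKBandit.le_pow_mul_add_sum
    (a := fun t => TopKBandit.OPT D k T
      - TopKBandit.expectedSTK D k (TopKBandit.epsGreedy g) t)
    (δ := fun t => K * (1 + Real.log T) * TopKBandit.explorationRate (t + 1))
    (r := 1 - 1 / T) (T := T)
    (by rw [sub_nonneg, div_le_one] <;> linarith)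
    (by rw [sub_le_self_iff]; positivity)
    (fun t => mul_nonneg hK0 (TopKBandit.explorationRate_succ_pos t).le)
    (fun t ht => TopKBandit.OPT_sub_expectedSTK_succ_le D hk hg ht)
  simp only [← Finset.mul_sum, TopKBandit.expectedSTK_zero, sub_zero] at hrec
  have h1 := mul_le_mul_of_nonneg_right (TopKBandit.one_sub_inv_pow_le hT)
    (TopKBandit.OPT_nonneg D k T)
  have h2 := mul_le_mul_of_nonneg_left (TopKBandit.sum_explorationRate_le T) hK0
  rw [pow_one]
  linarith
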